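/- Let $n\ge 2$ be an integer, let $0<\alpha\le\infty$ and let $I=[0,\alpha)$. For $f\colon I\to\mathbb R$ and a self-adjoint matrix $A\in M_k(\mathbb C)$ with all eigenvalues in $I$, let $f(A)$ be defined by the functional calculus, and order self-adjoint matrices by $A\le B$ if $B-A$ is positive semidefinite. A function $f\colon I\to\mathbb R$ is called $k$-monotone on $I$ if $A\le B$ implies $f(A)\le f(B)$, and $k$-convex on $I$ if $f(\lambda A+(1-\lambda)B)\le\lambda f(A)+(1-\lambda)f(B)$ for all $\lambda\in[0,1]$, in both cases for all self-adjoint $A,B\in M_k(\mathbb C)$ with all eigenvalues in $I$. Let $Q_n(I)$ be the class of all real $C^1$ functions $f$ on $I$ (with one-sided derivative at $0$) such that for all $\lambda_1,\dots,\lambda_n\in I$ the Loewner matrix $([\lambda_i,\lambda_j]_f)_{i,j=1}^n$, where $[s,t]_f=\frac{f(s)-f(t)}{s-t}$ for $s\ne t$ and $[t,t]_f=f'(t)$, is conditionally positive definite, that is, $\sum_{i,j}[\lambda_i,\lambda_j]_f\,\overline{x_i}x_j\ge 0$ for all $x\in\mathbb C^n$ with $\sum_i x_i=0$. If $f\in Q_n([0,\alpha))$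 and $f'$ is $(n-1)$-monotone on $[0,\alpha)$, then $f$ is $(n-1)$-convex on $[0,\alpha)$. -/

import Mathlib

open Matrix Set
open scoped ComplexOrder

noncomputable section

/-- The interval `[0, α)` of the real line, where `α` may be `∞`. -/
def halfOpenInterval (α : EReal) : Set ℝ :=
  {t : ℝ | 0 ≤ t ∧ (t : EReal) < α}

/-- `f` is `n`-monotone on `I`: `A ≤ B` implies `f(A) ≤ f(B)` for self-adjoint complex `n × n`
matrices with all eigenvalues in `I`. The order is the Loewner order, and `f(A)` is given by the
functional calculus (every `f` is continuous on the finite set `spectrum ℝ A`). -/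
def IsMatrixMonotoneOn (n : ℕ) (I : Set ℝ) (f : ℝ → ℝ) : Prop :=
  ∀ A B : Matrix (Fin n) (Fin n) ℂ, A.IsHermitian → B.IsHermitian →
    spectrum ℝ A ⊆ I → spectrum ℝ B ⊆ I →
    (B - A).PosSemidef → (cfc f B - cfc f A).PosSemidef

/-- `f` is `n`-convex on `I`: `f(cA + (1 - c)B) ≤ c f(A) + (1 - c) f(B)` for all `c ∈ [0, 1]` and
all self-adjoint complex `n × n` matrices with all eigenvalues in `I`. -/
def IsMatrixConvexOn (n : ℕ) (I : Set ℝ) (f : ℝ → ℝ) : Prop :=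
  ∀ A B : Matrix (Fin n) (Fin n) ℂ, A.IsHermitian → B.IsHermitian →
    spectrum ℝ A ⊆ I → spectrum ℝ B ⊆ I →
    ∀ c : ℝ, c ∈ Icc (0 : ℝ) 1 →
      ((c • cfc f A + (1 - c) • cfc f B) - cfc f (c • A + (1 - c) • B)).PosSemidef

/-- The first divided difference `[s, t]_f` of a function on `I`, with `[t, t]_f = f'(t)`; the
derivative is taken within `I`, hence one-sided at an endpoint that belongs to `I`. -/
def dividedDiff (I : Set ℝ) (f : ℝ → ℝ) (s t : ℝ) : ℝ :=
  if s = t then derivWithin f I s else (f s - f t) / (s - t)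

/-- The Loewner matrix `([λ_i, λ_j]_f)`. -/
def loewnerMatrix {n : ℕ} (I : Set ℝ) (f : ℝ → ℝ) (l : Fin n → ℝ) :
    Matrix (Fin n) (Fin n) ℂ :=
  Matrix.of fun i j => ((dividedDiff I f (l i) (l j) : ℝ) : ℂ)

/-- A Hermitian matrix is conditionally positive definite (almost positive) if its quadratic form
is nonnegative on all complex vectors whose coordinates sum to `0`. -/
def IsConditionallyPosDef {n : ℕ} (A : Matrix (Fin n) (Fin n) ℂ) : Prop :=
  A.IsHermitian ∧
    ∀ x : Fin n → ℂ, ∑ i, x i = 0 → 0 ≤ (star x ⬝ᵥ (A *ᵥ x)).re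

/-- The class `Q_n(I)`: real `C¹` functions on `I` all of whose `n × n` Loewner matrices at points
of `I` (not necessarily distinct) are conditionally positive definite. -/
def classQ (n : ℕ) (I : Set ℝ) : Set (ℝ → ℝ) :=
  {f | ContDiffOn ℝ 1 f I ∧
    ∀ l : Fin n → ℝ, (∀ i, l i ∈ I) → IsConditionallyPosDef (loewnerMatrix I f l)}

end

open Filter Topology

/-! Let k = n - 1 and let γ_i be the eigenvalues of C = cA + (1 - c)B. A Kraus-type criterion
reduces convexity to scalars: it is enough that for each x in I the matrix E(x)_ij = f(x) - f(γ_i) -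
[γ_i, γ_j]_f (x - γ_i) is positive semidefinite. In an eigenbasis of C, each spectral projection of
A or B contributes an entrywise product of E(eigenvalue) with a positive matrix, so its form is
nonnegative (`Matrix.IsHermitian.re_sum_conjTranspose_mul_cfc_nonneg`). In the weighted average the
factors [γ_i, γ_j] multiply only entries of C, which is diagonal there, and what remains is cf(A) +
(1 - c)f(B) - f(C).

For the criterion (`sum_interpolationError_nonneg`), divide E(x)_ij by (x - γ_i)(x - γ_j) to get the
second divided difference [γ_i, γ_j, x]. Its derivative in x is [γ_i, γ_j, x, x], and positivity of
that matrix is the conditional positivity of the Loewner matrix at γ_1, ..., γ_k, x: this is where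
Q_{k+1} enters. Hence the form G(x) = Σ w_i w_j [γ_i, γ_j, x] increases between nodes. Its value at
x = 0 is the Loewner form of (f(t) - f(0))/t = ∫₀¹ f'(st) ds, which inherits k-monotonicity from f',
so G(0) ≥ 0.

As f is only C¹, G may be unbounded at a node p. Comparing p + h with p - h, the singular terms
contribute a square times (f(p+h) - f(p-h) - 2hf'(p))/h², nonnegative by the two-point case of Q;
the other terms have a limit at p. So G never jumps down (`nonneg_of_deriv_nonneg_of_jump`). -/

lemma halfOpenInterval_mem_nhds {α : EReal} {t : ℝ} (ht : t ∈ halfOpenInterval α) (h0 : 0 < t) :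
    halfOpenInterval α ∈ 𝓝 t := by
  have h1 : ∀ᶠ s : ℝ in 𝓝 t, 0 < s := lt_mem_nhds h0
  have h2 : ∀ᶠ s : ℝ in 𝓝 t, (s : EReal) < α :=
    (continuous_coe_real_ereal.tendsto t).eventually (gt_mem_nhds ht.2)
  filter_upwards [h1, h2] with s hs hs' using ⟨hs.le, hs'⟩

lemma halfOpenInterval_mem_of_le {α : EReal} {s t : ℝ} (ht : t ∈ halfOpenInterval α)
    (h0 : 0 ≤ s) (hst : s ≤ t) : s ∈ halfOpenInterval α :=
  ⟨h0, (EReal.coe_le_coe_iff.2 hst).trans_lt ht.2⟩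

lemma convex_halfOpenInterval (α : EReal) : Convex ℝ (halfOpenInterval α) :=
  OrdConnected.convex
    ⟨fun _ hx _ hy _ hz => halfOpenInterval_mem_of_le hy (hx.1.trans hz.1) hz.2⟩

lemma eventually_add_mem_halfOpenInterval {α : EReal} {t : ℝ} (ht : t ∈ halfOpenInterval α) :
    ∀ᶠ e : ℝ in 𝓝[>] 0, t + e ∈ halfOpenInterval α := by
  have hc : Tendsto (fun e : ℝ => ((t + e : ℝ) : EReal)) (𝓝 0) (𝓝 ((t + 0 : ℝ) : EReal)) :=
    (continuous_coe_real_ereal.comp (continuous_const.add continuous_id)).tendsto 0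
  have h2 : ∀ᶠ e : ℝ in 𝓝 0, ((t + e : ℝ) : EReal) < α :=
    hc.eventually (gt_mem_nhds (by simpa using ht.2))
  filter_upwards [h2.filter_mono nhdsWithin_le_nhds, self_mem_nhdsWithin] with e he he0
  exact ⟨add_nonneg ht.1 (le_of_lt he0), he⟩

/-! ### First divided differences of C¹ functions on [0, α) -/

section DividedDiff

variable {α : EReal} {f : ℝ → ℝ}

lemma hasDerivAt_of_contDiffOn_halfOpenInterval (hf : ContDiffOn ℝ 1 f (halfOpenInterval α))
    {t : ℝ} (ht : t ∈ halfOpenInterval α) (h0 : 0 < t) :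
    HasDerivAt f (derivWithin f (halfOpenInterval α) t) t :=
  ((hf.differentiableOn one_ne_zero t ht).hasDerivWithinAt).hasDerivAt
    (halfOpenInterval_mem_nhds ht h0)

lemma uniqueDiffOn_halfOpenInterval (hα : 0 < α) : UniqueDiffOn ℝ (halfOpenInterval α) := by
  apply uniqueDiffOn_convex (convex_halfOpenInterval α)
  · have h0 : (0 : ℝ) ∈ halfOpenInterval α := ⟨le_rfl, by simpa using hα⟩
    obtain ⟨e, he, he0⟩ :=
      ((eventually_add_mem_halfOpenInterval h0).and self_mem_nhdsWithin).exists
    rw [zero_add] at he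
    exact ⟨e, mem_interior_iff_mem_nhds.2 (halfOpenInterval_mem_nhds he he0)⟩

lemma dividedDiff_self (I : Set ℝ) (f : ℝ → ℝ) (s : ℝ) :
    dividedDiff I f s s = derivWithin f I s := by
  simp [dividedDiff]

lemma dividedDiff_comm (I : Set ℝ) (f : ℝ → ℝ) (s t : ℝ) :
    dividedDiff I f s t = dividedDiff I f t s := by
  unfold dividedDiff
  by_cases h : s = t
  · simp [h]
  · rw [if_neg h, if_neg (Ne.symm h), ← neg_sub (f t), ← neg_sub t, neg_div_neg_eq]

lemma dividedDiff_mul_sub (I : Set ℝ) (f : ℝ → ℝ) (s t : ℝ) :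
    dividedDiff I f s t * (s - t) = f s - f t := by
  unfold dividedDiff
  by_cases h : s = t
  · simp [h]
  · rw [if_neg h, div_mul_cancel₀ _ (sub_ne_zero.2 h)]

lemma dividedDiff_eq_dslope (hf : ContDiffOn ℝ 1 f (halfOpenInterval α)) {s : ℝ}
    (hs : s ∈ halfOpenInterval α) (h0 : 0 < s) (t : ℝ) :
    dividedDiff (halfOpenInterval α) f s t = dslope f s t := by
  by_cases h : s = t
  · subst h
    rw [dividedDiff_self, dslope_same,
      (hasDerivAt_of_contDiffOn_halfOpenInterval hf hs h0).deriv]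
  · rw [dividedDiff_comm, dslope_of_ne _ (Ne.symm h), slope_def_field, dividedDiff,
      if_neg (Ne.symm h)]

end DividedDiff

/-! ### Scalar consequences of membership in Q_{k+1} -/

/-- The real quadratic form of a Loewner matrix of order `k + 1`, restricted to the vectors
with vanishing coordinate sum. -/
lemma classQ_sum_nonneg {k : ℕ} {I : Set ℝ} {f : ℝ → ℝ} (hf : f ∈ classQ (k + 1) I)
    {c : Fin k → ℝ} (hc : ∀ i, c i ∈ I) {t : ℝ} (ht : t ∈ I) (v : Fin k → ℝ) :
    0 ≤ ∑ i, ∑ j, v i * v j * (dividedDiff I f (c i) (c j) - dividedDiff I f (c i) t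
      - dividedDiff I f (c j) t + dividedDiff I f t t) := by
  -- The extra node `t` carries the weight -Σ v_j, which makes the coordinate sum vanish.
  have h := (hf.2 (Fin.cons t c) (Fin.cases ht hc)).2
    (fun i => ((Fin.cons (-∑ j, v j) v : Fin (k + 1) → ℝ) i : ℂ))
    (by rw [Fin.sum_univ_succ]; simp)
  refine h.trans_eq ?_
  have key : (star (fun i => ((Fin.cons (-∑ j, v j) v : Fin (k + 1) → ℝ) i : ℂ)) ⬝ᵥ
      (loewnerMatrix I f (Fin.cons t c) *ᵥ
        fun i => ((Fin.cons (-∑ j, v j) v : Fin (k + 1) → ℝ) i : ℂ))) =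
      ((∑ i, ∑ j, (Fin.cons (-∑ j, v j) v : Fin (k + 1) → ℝ) i *
        (Fin.cons (-∑ j, v j) v : Fin (k + 1) → ℝ) j *
        dividedDiff I f ((Fin.cons t c : Fin (k + 1) → ℝ) i)
          ((Fin.cons t c : Fin (k + 1) → ℝ) j) : ℝ) : ℂ) := by
    simp only [dotProduct, mulVec, loewnerMatrix, Matrix.of_apply, Pi.star_apply,
      Complex.star_def, Complex.conj_ofReal, Finset.mul_sum]
    push_cast
    refine Finset.sum_congr rfl fun i _ => Finset.sum_congr rfl fun j _ => ?_
    ring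
  rw [key, Complex.ofReal_re]
  simp only [Fin.sum_univ_succ, Fin.cons_zero, Fin.cons_succ]
  set S := ∑ j, v j with hS
  have e1 : ∑ j, v j * dividedDiff I f t (c j) = ∑ j, v j * dividedDiff I f (c j) t :=
    Finset.sum_congr rfl fun j _ => by rw [dividedDiff_comm]
  have e2 : ∑ i, ∑ j, v i * v j * (dividedDiff I f (c i) (c j) - dividedDiff I f (c i) t
      - dividedDiff I f (c j) t + dividedDiff I f t t) =
      (∑ i, ∑ j, v i * v j * dividedDiff I f (c i) (c j))
        - 2 * (S * ∑ j, v j * dividedDiff I f (c j) t) + S * S * dividedDiff I f t t := by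
    have a1 : S * ∑ j, v j * dividedDiff I f (c j) t
        = ∑ i, ∑ j, v i * v j * dividedDiff I f (c j) t := by
      rw [hS, Finset.sum_mul_sum]
      simp only [mul_assoc]
    have a2 : S * ∑ j, v j * dividedDiff I f (c j) t
        = ∑ i, ∑ j, v i * v j * dividedDiff I f (c i) t := by
      rw [a1, Finset.sum_comm]
      exact Finset.sum_congr rfl fun i _ => Finset.sum_congr rfl fun j _ => by ring
    have a3 : S * S * dividedDiff I f t t = ∑ i, ∑ j, v i * v j * dividedDiff I f t t := by
      rw [hS, Finset.sum_mul_sum, Finset.sum_mul]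
      simp only [Finset.sum_mul]
    rw [two_mul, a3]
    nth_rewrite 1 [a2]
    rw [a1]
    simp only [← Finset.sum_add_distrib, ← Finset.sum_sub_distrib]
    exact Finset.sum_congr rfl fun i _ => Finset.sum_congr rfl fun j _ => by ring
  rw [e2]
  have e3 : ∑ j, -S * v j * dividedDiff I f t (c j) = -(S * ∑ j, v j * dividedDiff I f (c j) t) := by
    rw [← e1, ← neg_mul, Finset.mul_sum]
    simp only [mul_assoc]
  have e4 : ∑ i, v i * -S * dividedDiff I f (c i) t = -(S * ∑ j, v j * dividedDiff I f (c j) t) := by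
    rw [← neg_mul, Finset.mul_sum]
    exact Finset.sum_congr rfl fun i _ => by ring
  rw [Finset.sum_add_distrib, e3, e4]
  ring

/-- This is the test vector (1, -1) on the two-point Loewner matrix at `s`, `t`; repeating the node
`s` embeds it in order k + 1. -/
lemma classQ_two_mul_dividedDiff_le {k : ℕ} (hk : 1 ≤ k) {I : Set ℝ} {f : ℝ → ℝ}
    (hf : f ∈ classQ (k + 1) I) {s t : ℝ} (hs : s ∈ I) (ht : t ∈ I) :
    2 * dividedDiff I f s t ≤ derivWithin f I s + derivWithin f I t := by
  have h := classQ_sum_nonneg hf (c := fun _ => s) (fun _ => hs) ht (Pi.single ⟨0, hk⟩ 1)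
  simp [Pi.single_apply, dividedDiff_self] at h
  linarith

/-- The symmetric difference quotient of `f` is at least its derivative. -/
lemma classQ_two_mul_derivWithin_le {k : ℕ} (hk : 1 ≤ k) {α : EReal} {f : ℝ → ℝ}
    (hf : f ∈ classQ (k + 1) (halfOpenInterval α)) {p h : ℝ} (hh : 0 < h) (hph : 0 < p - h)
    (hp : p + h ∈ halfOpenInterval α) :
    2 * h * derivWithin f (halfOpenInterval α) p ≤ f (p + h) - f (p - h) := by
  set I := halfOpenInterval α with hI
  have hmem : ∀ s, |s| ≤ h → p + s ∈ I ∧ 0 < p + s := fun s hs => by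
    have := abs_le.1 hs
    exact ⟨halfOpenInterval_mem_of_le hp (by linarith) (by linarith), by linarith⟩
  have hd : ∀ s, |s| ≤ h → HasDerivAt f (derivWithin f I (p + s)) (p + s) := fun s hs =>
    hasDerivAt_of_contDiffOn_halfOpenInterval hf.1 (hmem s hs).1 (hmem s hs).2
  -- The two-point inequality at p + s and p - s says exactly that φ' ≥ 0, while φ tends to 2f'(p)
  -- at 0.
  let φ : ℝ → ℝ := fun s => (f (p + s) - f (p - s)) / s
  have hφd : ∀ s ∈ Ioc 0 h, HasDerivAt φ
      (((derivWithin f I (p + s) + derivWithin f I (p - s)) * s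
        - (f (p + s) - f (p - s)) * 1) / s ^ 2) s := by
    intro s hs
    have h1 : HasDerivAt (fun s => f (p + s)) (derivWithin f I (p + s)) s := by
      simpa using! (hd s (by rw [abs_of_pos hs.1]; exact hs.2)).comp_const_add p s
    have h2 : HasDerivAt (fun s => f (p - s)) (-derivWithin f I (p - s)) s := by
      have := hd (-s) (by rw [abs_neg, abs_of_pos hs.1]; exact hs.2)
      rw [← sub_eq_add_neg] at this
      simpa using! this.comp_const_sub p s
    have h3 := (h1.sub h2).div (hasDerivAt_id s) hs.1.ne'
    rw [sub_neg_eq_add] at h3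
    exact h3
  have hmono : MonotoneOn φ (Ioc 0 h) := by
    refine monotoneOn_of_deriv_nonneg (convex_Ioc 0 h)
      (fun s hs => (hφd s hs).continuousAt.continuousWithinAt)
      (fun s hs => (hφd s (interior_subset hs)).differentiableAt.differentiableWithinAt)
      (fun s hs => ?_)
    have hs := interior_subset hs
    rw [(hφd s hs).deriv]
    have hq := classQ_two_mul_dividedDiff_le hk hf
      (hmem s (by rw [abs_of_pos hs.1]; exact hs.2)).1
      (hmem (-s) (by rw [abs_neg, abs_of_pos hs.1]; exact hs.2)).1
    have hm := dividedDiff_mul_sub I f (p + s) (p + -s)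
    rw [← sub_eq_add_neg] at hq hm
    apply div_nonneg _ (sq_nonneg s)
    have := mul_le_mul_of_nonneg_right hq hs.1.le
    have h2 : (p + s) - (p - s) = 2 * s := by ring
    rw [h2] at hm
    linarith
  have hlim : Tendsto φ (𝓝[>] 0) (𝓝 (2 * derivWithin f I p)) := by
    have h1 : HasDerivAt (fun s => f (p + s)) (derivWithin f I p) 0 := by
      have := hd 0 (by simpa using hh.le)
      simpa using! this.comp_const_add p 0
    have h2 : HasDerivAt (fun s => f (p - s)) (-derivWithin f I p) 0 := by
      have := hd 0 (by simpa using hh.le)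
      rw [add_zero] at this
      have h3 : HasDerivAt f (derivWithin f I p) (p - 0) := by simpa using this
      simpa using! h3.comp_const_sub p 0
    have h3 := (h1.sub h2).tendsto_slope_zero_right
    rw [sub_neg_eq_add, ← two_mul] at h3
    refine h3.congr fun s => ?_
    simp [φ, div_eq_inv_mul]
  have hle : 2 * derivWithin f I p ≤ φ h := by
    refine le_of_tendsto hlim ?_
    filter_upwards [Ioc_mem_nhdsGT hh] with s hs
    exact hmono hs ⟨hh, le_rfl⟩ hs.2
  have := (le_div_iff₀ hh).1 hle
  linarith

/-! ### Functional calculus and positivity of Loewner matrices -/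

section Cfc

variable {k : ℕ}

lemma Matrix.IsHermitian.cfc_apply_eq_sum {A : Matrix (Fin k) (Fin k) ℂ} (hA : A.IsHermitian)
    (f : ℝ → ℝ) (i j : Fin k) :
    cfc f A i j = ∑ l, (f (hA.eigenvalues l) : ℂ) *
      ((hA.eigenvectorUnitary : Matrix (Fin k) (Fin k) ℂ) i l *
        star ((hA.eigenvectorUnitary : Matrix (Fin k) (Fin k) ℂ) j l)) := by
  rw [hA.cfc_eq, IsHermitian.cfc, Unitary.conjStarAlgAut_apply, Matrix.mul_apply]
  refine Finset.sum_congr rfl fun l _ => ?_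
  rw [Matrix.mul_diagonal, Matrix.star_apply]
  simp only [Function.comp_apply, Complex.coe_algebraMap]
  ring

lemma Matrix.continuousOn_spectrum_real {A : Matrix (Fin k) (Fin k) ℂ}
    (f : ℝ → ℝ) : ContinuousOn f (spectrum ℝ A) :=
  Matrix.finite_real_spectrum.continuousOn f

/-- `g(B) - g(a) = (B - a) q(B)` if `g(x) - g(a) = (x - a) q(x)`. -/
lemma Matrix.IsHermitian.cfc_sub_smul_one {B : Matrix (Fin k) (Fin k) ℂ} (hB : B.IsHermitian)
    {g q : ℝ → ℝ} {a : ℝ} (hq : ∀ x, g x - g a = (x - a) * q x) :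
    cfc g B - g a • (1 : Matrix (Fin k) (Fin k) ℂ) = (B - a • 1) * cfc q B := by
  have hc : ∀ f : ℝ → ℝ, ContinuousOn f (spectrum ℝ B) := Matrix.continuousOn_spectrum_real
  have hB' : IsSelfAdjoint B := hB
  have h1 : cfc (fun x => g x - g a) B = cfc g B - g a • (1 : Matrix (Fin k) (Fin k) ℂ) := by
    rw [cfc_sub _ _ B (hc _) (hc _), cfc_const _ B, Algebra.algebraMap_eq_smul_one]
  have h2 : cfc (fun x => (x - a) * q x) B = (B - a • 1) * cfc q B := by
    rw [cfc_mul _ _ B (hc _) (hc _), cfc_sub _ _ B (hc _) (hc _), cfc_const _ B, cfc_id' ℝ B,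
      Algebra.algebraMap_eq_smul_one]
  rw [← h1, ← h2]
  congr 1
  funext x
  exact hq x

lemma isHermitian_diagonal_ofReal (c : Fin k → ℝ) :
    (diagonal fun i => (c i : ℂ)).IsHermitian :=
  isHermitian_diagonal_of_self_adjoint _ (by ext i; simp)

/-- Row i of D - c_i vanishes, and g(D) - g(c_i) = (D - c_i) q(D), so row i of g(D) - g(c_i)
vanishes too. -/
lemma cfc_diagonal_ofReal (c : Fin k → ℝ) (g : ℝ → ℝ) :
    cfc g (diagonal fun i => (c i : ℂ)) = diagonal fun i => (g (c i) : ℂ) := by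
  ext i j
  have h := (isHermitian_diagonal_ofReal c).cfc_sub_smul_one (g := g)
    (q := fun x => (g x - g (c i)) / (x - c i)) (a := c i) (fun x => by
      by_cases hx : x = c i
      · simp [hx]
      · rw [mul_div_cancel₀ _ (sub_ne_zero.2 hx)])
  have h := congrFun (congrFun h i) j
  have h0 : ∀ l, ((diagonal fun i => (c i : ℂ)) - c i • (1 : Matrix (Fin k) (Fin k) ℂ)) i l = 0 := by
    intro l
    by_cases hl : i = l
    · subst hl; simp
    · simp [hl]
  rw [Matrix.mul_apply] at h
  simp only [h0, zero_mul, Finset.sum_const_zero, Matrix.sub_apply, sub_eq_zero] at h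
  rw [h]
  by_cases hl : i = j
  · subst hl; simp
  · simp [hl]

lemma spectrum_diagonal_ofReal (c : Fin k → ℝ) :
    spectrum ℝ (diagonal fun i => (c i : ℂ)) = range c := by
  ext x
  rw [← spectrum.algebraMap_mem_iff ℂ, spectrum_diagonal]
  simp

open scoped Matrix.Norms.L2Operator in
/-- The Loewner matrix of a `k`-monotone function is positive semidefinite. -/
lemma loewner_sum_nonneg_of_monotone {U : Set ℝ} (hU : IsOpen U) {g : ℝ → ℝ}
    (hg : DifferentiableOn ℝ g U) (hmono : IsMatrixMonotoneOn k U g)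
    {c : Fin k → ℝ} (hc : ∀ i, c i ∈ U) (v : Fin k → ℝ) :
    0 ≤ ∑ i, ∑ j, v i * v j * dslope g (c i) (c j) := by
  set A : Matrix (Fin k) (Fin k) ℂ := diagonal fun i => (c i : ℂ) with hA
  have hAh : A.IsHermitian := isHermitian_diagonal_ofReal c
  let w : Fin k → ℂ := fun i => (v i : ℂ)
  -- With the weights put into the direction of the rank-one perturbation, the all-ones vector
  -- suffices as test vector.
  let J : Matrix (Fin k) (Fin k) ℂ := vecMulVec w (star w)
  have hJ : J.PosSemidef := posSemidef_vecMulVec_self_star w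
  let B : ℝ → Matrix (Fin k) (Fin k) ℂ := fun t => A + t • J
  have hBh : ∀ t, (B t).IsHermitian := fun t =>
    hAh.add (hJ.isHermitian.smul (IsSelfAdjoint.all t))
  have hsA : spectrum ℝ A = range c := spectrum_diagonal_ofReal c
  have hfin : (spectrum ℝ A) ⊆ U := by rw [hsA]; rintro _ ⟨i, rfl⟩; exact hc i
  obtain ⟨K, hK, hAK, hKU⟩ := exists_compact_between
    (Matrix.finite_real_spectrum (A := A)).isCompact hU hfin
  have hBc : Tendsto B (𝓝 0) (𝓝 A) := by
    have : Continuous B := continuous_const.add (continuous_id.smul continuous_const)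
    simpa [B] using this.tendsto 0
  have hsB : ∀ᶠ t in 𝓝 (0 : ℝ), spectrum ℝ (B t) ⊆ K := by
    have h1 := upperHemicontinuous_spectrum ℝ (Matrix (Fin k) (Fin k) ℂ) A (interior K)
      (isOpen_interior.mem_nhdsSet.2 hAK)
    filter_upwards [hBc.eventually h1] with t ht
    exact (subset_of_mem_nhdsSet ht).trans interior_subset
  have hq : ∀ i, Tendsto (fun t => cfc (dslope g (c i)) (B t)) (𝓝 0)
      (𝓝 (diagonal fun j => ((dslope g (c i) (c j) : ℝ) : ℂ))) := by
    intro i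
    rw [← cfc_diagonal_ofReal]
    refine Filter.Tendsto.cfc hK _ hBc hsB (Eventually.of_forall fun t => hBh t)
      (hAK.trans interior_subset) hAh ?_
    exact ((continuousOn_dslope (hU.mem_nhds (hc i))).2 ⟨hg.continuousOn,
      (hg.differentiableAt (hU.mem_nhds (hc i)))⟩).mono hKU
  -- Row i of B(t) - c_i is t w_i w^T, so the difference is exactly divisible by t. Only
  -- differentiability of `g` is needed, and the c_i may coincide.
  have hentry : ∀ t i j, (cfc g (B t) - cfc g A) i j
      = t * (w i * ∑ m, w m * cfc (dslope g (c i)) (B t) m j) := by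
    intro t i j
    have h := (hBh t).cfc_sub_smul_one (g := g) (q := dslope g (c i)) (a := c i)
      (fun x => by rw [← smul_eq_mul, sub_smul_dslope])
    have h := congrFun (congrFun h i) j
    have e1 : (cfc g (B t) - cfc g A) i j
        = (cfc g (B t) - g (c i) • (1 : Matrix (Fin k) (Fin k) ℂ)) i j := by
      rw [hA, cfc_diagonal_ofReal]
      by_cases hij : i = j
      · subst hij; simp
      · simp [hij]
    have e2 : ∀ m, (B t - c i • (1 : Matrix (Fin k) (Fin k) ℂ)) i m = t * (w i * w m) := by
      intro m
      by_cases him : i = m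
      · subst him; simp [B, J, vecMulVec_apply, w, hA]
      · simp [B, J, vecMulVec_apply, w, hA, him]
    rw [e1, h, Matrix.mul_apply, Finset.mul_sum, Finset.mul_sum]
    refine Finset.sum_congr rfl fun m _ => ?_
    rw [e2]; ring
  have hlim : Tendsto (fun t => ∑ i, ∑ j, w i * ∑ m, w m * cfc (dslope g (c i)) (B t) m j)
      (𝓝[>] 0) (𝓝 (∑ i, ∑ j, w i * ∑ m, w m *
        (diagonal fun j => ((dslope g (c i) (c j) : ℝ) : ℂ)) m j)) := by
    refine Tendsto.mono_left ?_ nhdsWithin_le_nhds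
    refine tendsto_finsetSum _ fun i _ => tendsto_finsetSum _ fun j _ =>
      Tendsto.const_mul _ (tendsto_finsetSum _ fun m _ => Tendsto.const_mul _ ?_)
    exact ((continuous_apply_apply m j).tendsto _).comp (hq i)
  have hlimit : ∑ i, ∑ j, w i * ∑ m, w m *
        (diagonal fun j => ((dslope g (c i) (c j) : ℝ) : ℂ)) m j
      = ((∑ i, ∑ j, v i * v j * dslope g (c i) (c j) : ℝ) : ℂ) := by
    push_cast
    refine Finset.sum_congr rfl fun i _ => Finset.sum_congr rfl fun j _ => ?_
    rw [Finset.sum_eq_single j]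
    · simp [w, mul_assoc]
    · intro m _ hm; simp [hm]
    · simp
  rw [hlimit] at hlim
  have hre := (Complex.continuous_re.tendsto _).comp hlim
  rw [Complex.ofReal_re] at hre
  refine ge_of_tendsto hre ?_
  filter_upwards [hsB.filter_mono nhdsWithin_le_nhds, self_mem_nhdsWithin] with t ht ht0
  have ht0 : 0 < t := ht0
  have hps := hmono A (B t) hAh (hBh t) hfin (ht.trans hKU)
    (by simpa [B] using hJ.smul ht0.le)
  have h1 := hps.re_dotProduct_nonneg 1
  have h2 : star (1 : Fin k → ℂ) ⬝ᵥ ((cfc g (B t) - cfc g A) *ᵥ 1)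
      = t * ∑ i, ∑ j, w i * ∑ m, w m * cfc (dslope g (c i)) (B t) m j := by
    simp only [dotProduct, mulVec, hentry, Pi.star_apply, Pi.one_apply, star_one, one_mul, mul_one,
      Finset.mul_sum]
  rw [h2, RCLike.re_eq_complex_re, Complex.re_ofReal_mul] at h1
  exact nonneg_of_mul_nonneg_right h1 ht0

end Cfc

/-! ### Monotonicity of (f(t) - f(0))/t -/

section Average

variable {k : ℕ}

lemma Matrix.IsHermitian.posSemidef_of_re_nonneg {M : Matrix (Fin k) (Fin k) ℂ}
    (hM : M.IsHermitian) (h : ∀ v, 0 ≤ (star v ⬝ᵥ (M *ᵥ v)).re) : M.PosSemidef := by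
  refine PosSemidef.of_dotProduct_mulVec_nonneg hM fun v => ?_
  rw [Complex.nonneg_iff]
  exact ⟨h v, (hM.im_star_dotProduct_mulVec_self v).symm⟩

lemma isHermitian_cfc (f : ℝ → ℝ) (A : Matrix (Fin k) (Fin k) ℂ) : (cfc f A).IsHermitian :=
  cfc_predicate f A

lemma Matrix.IsHermitian.re_dotProduct_cfc_mulVec {A : Matrix (Fin k) (Fin k) ℂ}
    (hA : A.IsHermitian) (f : ℝ → ℝ) (v : Fin k → ℂ) :
    (star v ⬝ᵥ (cfc f A *ᵥ v)).re = ∑ l, f (hA.eigenvalues l) * Complex.normSq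
      (∑ i, star ((hA.eigenvectorUnitary : Matrix (Fin k) (Fin k) ℂ) i l) * v i) := by
  have : star v ⬝ᵥ (cfc f A *ᵥ v) = ((∑ l, f (hA.eigenvalues l) * Complex.normSq
      (∑ i, star ((hA.eigenvectorUnitary : Matrix (Fin k) (Fin k) ℂ) i l) * v i) : ℝ) : ℂ) := by
    push_cast
    simp only [Complex.normSq_eq_conj_mul_self, map_sum, map_mul, dotProduct, mulVec,
      hA.cfc_apply_eq_sum, Finset.mul_sum, Finset.sum_mul,
      Complex.star_def, Complex.conj_conj, Pi.star_apply]
    calc _ = ∑ i, ∑ l, ∑ j, _ := Finset.sum_congr rfl fun i _ => Finset.sum_comm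
      _ = _ := by
        rw [Finset.sum_comm]
        refine Finset.sum_congr rfl fun l _ => ?_
        rw [Finset.sum_comm]
        refine Finset.sum_congr rfl fun i _ => Finset.sum_congr rfl fun j _ => ?_
        ring
  rw [this, Complex.ofReal_re]

lemma Matrix.IsHermitian.cfc_smul {A : Matrix (Fin k) (Fin k) ℂ} (hA : A.IsHermitian)
    (f : ℝ → ℝ) (s : ℝ) : cfc f (s • A) = cfc (fun x => f (s * x)) A := by
  have hA' : IsSelfAdjoint A := hA
  exact (cfc_comp_smul s f A
    ((Matrix.finite_real_spectrum (A := A)).image _ |>.continuousOn f)).symm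

lemma Matrix.IsHermitian.spectrum_smul_subset {A : Matrix (Fin k) (Fin k) ℂ}
    (hA : A.IsHermitian) {α : EReal} {s : ℝ} (hs : s ∈ Icc (0 : ℝ) 1)
    (h : spectrum ℝ A ⊆ halfOpenInterval α) : spectrum ℝ (s • A) ⊆ halfOpenInterval α := by
  rcases isEmpty_or_nonempty (Fin k) with hk | hk
  · intro x hx
    exact absurd (isUnit_of_subsingleton _) (spectrum.mem_iff.1 hx)
  · rw [spectrum.smul_eq_smul s A (ContinuousFunctionalCalculus.spectrum_nonempty A hA)]
    rintro _ ⟨x, hx, rfl⟩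
    have hx := h hx
    exact halfOpenInterval_mem_of_le hx (mul_nonneg hs.1 hx.1)
      (mul_le_of_le_one_left hx.1 hs.2)

/-- If `f'` is `k`-monotone on `[0, α)`, then so is `(f(t) - f(0)) / t = ∫₀¹ f'(st) ds` on
`(0, α)`. -/
lemma isMatrixMonotoneOn_div {α : EReal} {f : ℝ → ℝ}
    (hf : ContDiffOn ℝ 1 f (halfOpenInterval α))
    (hmono : IsMatrixMonotoneOn k (halfOpenInterval α) (derivWithin f (halfOpenInterval α))) :
    IsMatrixMonotoneOn k (interior (halfOpenInterval α) ∩ Ioi 0) fun t => (f t - f 0) / t := by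
  intro A B hA hB hsA hsB hAB
  set I := halfOpenInterval α with hI
  refine ((isHermitian_cfc _ B).sub (isHermitian_cfc _ A)).posSemidef_of_re_nonneg fun v => ?_
  rw [sub_mulVec, dotProduct_sub, Complex.sub_re, sub_nonneg]
  -- The integral is replaced by its primitive in s: Ψ_X vanishes at 0, has derivative ⟨v, f'(sX)v⟩,
  -- and at 1 gives the form of the quotient function.
  let Ψ : Matrix (Fin k) (Fin k) ℂ → ℝ → ℝ := fun X s =>
    (star v ⬝ᵥ (cfc (fun x => (f (s * x) - f 0) / x) X *ᵥ v)).re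
  have hsI : ∀ {x : ℝ}, x ∈ interior I ∩ Ioi 0 → ∀ s ∈ Icc (0 : ℝ) 1, s * x ∈ I := by
    intro x hx s hs
    exact halfOpenInterval_mem_of_le (interior_subset hx.1) (mul_nonneg hs.1 (le_of_lt hx.2))
      (mul_le_of_le_one_left (le_of_lt hx.2) hs.2)
  have hcont : ∀ X : Matrix (Fin k) (Fin k) ℂ, X.IsHermitian →
      spectrum ℝ X ⊆ interior I ∩ Ioi 0 → ContinuousOn (Ψ X) (Icc 0 1) := by
    intro X hX hsX
    simp only [Ψ, hX.re_dotProduct_cfc_mulVec]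
    refine continuousOn_finsetSum _ fun l _ => ContinuousOn.mul ?_ continuousOn_const
    refine ContinuousOn.div_const (ContinuousOn.sub ?_ continuousOn_const) _
    exact hf.continuousOn.comp (by fun_prop)
      fun s hs => hsI (hsX (hX.eigenvalues_mem_spectrum_real l)) s hs
  have hder : ∀ X : Matrix (Fin k) (Fin k) ℂ, X.IsHermitian →
      spectrum ℝ X ⊆ interior I ∩ Ioi 0 → ∀ s ∈ Ioo (0 : ℝ) 1,
      HasDerivAt (Ψ X) (star v ⬝ᵥ (cfc (derivWithin f I) (s • X) *ᵥ v)).re s := by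
    intro X hX hsX s hs
    simp only [Ψ, hX.cfc_smul, hX.re_dotProduct_cfc_mulVec]
    refine HasDerivAt.fun_sum fun l _ => HasDerivAt.mul_const ?_ _
    have hx := hsX (hX.eigenvalues_mem_spectrum_real l)
    have hx0 : 0 < hX.eigenvalues l := hx.2
    have h1 := (hasDerivAt_of_contDiffOn_halfOpenInterval hf (hsI hx s ⟨hs.1.le, hs.2.le⟩)
      (mul_pos hs.1 hx0)).comp s ((hasDerivAt_id s).mul_const (hX.eigenvalues l))
    have h2 := (h1.sub_const (f 0)).div_const (hX.eigenvalues l)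
    rw [one_mul, mul_div_cancel_right₀ _ hx0.ne'] at h2
    exact h2
  have hsub : ∀ {X : Matrix (Fin k) (Fin k) ℂ}, spectrum ℝ X ⊆ interior I ∩ Ioi 0 →
      spectrum ℝ X ⊆ I := fun h => h.trans (inter_subset_left.trans interior_subset)
  have hmon : MonotoneOn (fun s => Ψ B s - Ψ A s) (Icc 0 1) := by
    refine monotoneOn_of_deriv_nonneg (convex_Icc 0 1) ((hcont B hB hsB).sub (hcont A hA hsA)) ?_ ?_
    · rw [interior_Icc]
      exact fun s hs => ((hder B hB hsB s hs).sub
        (hder A hA hsA s hs)).differentiableAt.differentiableWithinAt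
    · rw [interior_Icc]
      intro s hs
      have hs' : s ∈ Icc (0 : ℝ) 1 := ⟨hs.1.le, hs.2.le⟩
      have hd := ((hder B hB hsB s hs).sub (hder A hA hsA s hs)).deriv
      rw [show deriv (fun s => Ψ B s - Ψ A s) s = _ from hd]
      have hp := hmono (s • A) (s • B) (hA.smul (IsSelfAdjoint.all s))
        (hB.smul (IsSelfAdjoint.all s)) (hA.spectrum_smul_subset hs' (hsub hsA))
        (hB.spectrum_smul_subset hs' (hsub hsB)) (by rw [← smul_sub]; exact hAB.smul hs.1.le)
      have := hp.re_dotProduct_nonneg v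
      rwa [sub_mulVec, dotProduct_sub, RCLike.re_eq_complex_re, Complex.sub_re] at this
  have h01 := hmon (left_mem_Icc.2 zero_le_one) (right_mem_Icc.2 zero_le_one) zero_le_one
  have hz : ∀ X : Matrix (Fin k) (Fin k) ℂ, X.IsHermitian → Ψ X 0 = 0 := by
    intro X hX
    simp [Ψ, hX.re_dotProduct_cfc_mulVec]
  simp only [hz A hA, hz B hB, sub_self, Ψ, one_mul, sub_nonneg] at h01
  exact h01

end Average

/-! ### Interpolation errors and their sign at the left endpoint -/

/-- The error of the linear interpolation of `f` at `s` and `t`, evaluated at `a`. -/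
noncomputable def interpolationError (I : Set ℝ) (f : ℝ → ℝ) (s t a : ℝ) : ℝ :=
  f a - f s - dividedDiff I f s t * (a - s)

lemma interpolationError_comm (I : Set ℝ) (f : ℝ → ℝ) (s t a : ℝ) :
    interpolationError I f s t a = interpolationError I f t s a := by
  have h := dividedDiff_mul_sub I f s t
  unfold interpolationError
  rw [dividedDiff_comm I f t s]
  linear_combination h

/-- At 0 the error is c_i c_j times the Loewner entry of (f(t) - f(0))/t; the factors c_i are
absorbed into the weights. It supplies the initial value G(0) ≥ 0. -/
lemma sum_interpolationError_zero_nonneg {k : ℕ} {α : EReal} {f : ℝ → ℝ}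
    (hf : ContDiffOn ℝ 1 f (halfOpenInterval α))
    (hmono : IsMatrixMonotoneOn k (halfOpenInterval α) (derivWithin f (halfOpenInterval α)))
    {c : Fin k → ℝ} (hc : ∀ i, c i ∈ halfOpenInterval α) (hc0 : ∀ i, 0 < c i) (v : Fin k → ℝ) :
    0 ≤ ∑ i, ∑ j, v i * v j * interpolationError (halfOpenInterval α) f (c i) (c j) 0 := by
  set I := halfOpenInterval α with hI
  have hdf : ∀ t ∈ interior I ∩ Ioi 0,
      HasDerivAt (fun t => (f t - f 0) / t) ((derivWithin f I t * t - (f t - f 0)) / t ^ 2) t := by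
    intro t ht
    have ht0 : 0 < t := ht.2
    have h := ((hasDerivAt_of_contDiffOn_halfOpenInterval hf (interior_subset ht.1)
      ht.2).sub_const (f 0)).div (hasDerivAt_id t) ht0.ne'
    rw [id_eq, mul_one] at h
    exact h
  have hcU : ∀ i, c i ∈ interior I ∩ Ioi 0 := fun i =>
    ⟨mem_interior_iff_mem_nhds.2 (halfOpenInterval_mem_nhds (hc i) (hc0 i)), hc0 i⟩
  have h := loewner_sum_nonneg_of_monotone (isOpen_interior.inter isOpen_Ioi)
    (fun t ht => (hdf t ht).differentiableAt.differentiableWithinAt)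
    (isMatrixMonotoneOn_div hf hmono) hcU (fun i => v i * c i)
  refine h.trans_eq (Finset.sum_congr rfl fun i _ => Finset.sum_congr rfl fun j _ => ?_)
  have key : dslope (fun t => (f t - f 0) / t) (c i) (c j) * (c i * c j) =
      interpolationError I f (c i) (c j) 0 := by
    have hi := (hc0 i).ne'
    have hj := (hc0 j).ne'
    unfold interpolationError
    by_cases hij : c i = c j
    · rw [← hij, dslope_same, (hdf _ (hcU i)).deriv, dividedDiff_self]
      field_simp
      ring
    · have hij' : c j - c i ≠ 0 := sub_ne_zero.2 (Ne.symm hij)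
      have hij'' : c i - c j ≠ 0 := sub_ne_zero.2 hij
      rw [dslope_of_ne _ (Ne.symm hij), slope_def_field, dividedDiff, if_neg hij]
      field_simp
      ring
  rw [← key]
  ring

/-! ### Monotonicity across finitely many singular points -/

/-- A function that is nondecreasing off a finite set, and does not jump down at the points of that
set, stays nonnegative. -/
lemma nonneg_of_deriv_nonneg_of_jump {b : ℝ} {F : Finset ℝ} {G G' : ℝ → ℝ}
    (hcont : ContinuousOn G (Icc 0 b \ F))
    (hderiv : ∀ x ∈ Ioo 0 b, x ∉ F → HasDerivAt G (G' x) x ∧ 0 ≤ G' x)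
    (hF : ∀ p ∈ F, 0 < p) (h0 : 0 ≤ G 0)
    (hjump : ∀ p ∈ F, p < b → ∀ ε > 0, ∀ᶠ h in 𝓝[>] 0, G (p - h) - ε ≤ G (p + h))
    {x : ℝ} (hx : x ∈ Icc 0 b) (hxF : x ∉ F) : 0 ≤ G x := by
  have hmono : ∀ s ∈ Icc 0 b, ∀ t ∈ Icc 0 b, s ≤ t → (∀ p ∈ F, p ∉ Icc s t) → G s ≤ G t := by
    intro s hs t ht hst hp
    have hm : MonotoneOn G (Icc s t) := by
      refine monotoneOn_of_deriv_nonneg (convex_Icc s t)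
        (hcont.mono fun y hy => ⟨⟨hs.1.trans hy.1, hy.2.trans ht.2⟩, fun h => hp y h hy⟩) ?_ ?_ <;>
      · rw [interior_Icc]
        intro y hy
        have := hderiv y ⟨hs.1.trans_lt hy.1, hy.2.trans_le ht.2⟩
          (fun h => hp y h ⟨hy.1.le, hy.2.le⟩)
        first
          | exact this.1.differentiableAt.differentiableWithinAt
          | rw [this.1.deriv]; exact this.2
    exact hm ⟨le_rfl, hst⟩ ⟨hst, le_rfl⟩ hst
  -- Induction on the number of exceptional points below x: cross the largest one, p, by 0 ≤ G(p-h)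
  -- ≤ G(p+h) + ε ≤ G(x) + ε.
  induction hn : (F.filter (· < x)).card using Nat.strong_induction_on generalizing x with
  | _ n ih =>
    rcases (F.filter (· < x)).eq_empty_or_nonempty with he | hne
    · refine h0.trans (hmono 0 ⟨le_rfl, hx.1.trans hx.2⟩ x hx hx.1 fun p hp hpx => ?_)
      have hlt : p < x := lt_of_le_of_ne hpx.2 fun h => hxF (h ▸ hp)
      exact Finset.notMem_empty p (he ▸ Finset.mem_filter.2 ⟨hp, hlt⟩)
    · obtain ⟨p, hp, hpmax⟩ := (F.filter (· < x)).exists_max_image id hne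
      obtain ⟨hpF, hpx⟩ := Finset.mem_filter.1 hp
      have hp0 := hF p hpF
      refine le_of_forall_pos_le_add fun ε hε => ?_
      have e1 : ∀ᶠ h in 𝓝[>] (0 : ℝ), p - h ∉ F := by
        have : ∀ᶠ y in 𝓝[<] p, y ∉ F := by
          have h1 : ∀ᶠ y in 𝓝 p, y ∉ F.erase p :=
            (F.erase p).finite_toSet.isClosed.isOpen_compl.mem_nhds (by simp)
          filter_upwards [h1.filter_mono nhdsWithin_le_nhds, self_mem_nhdsWithin] with y hy hyp hyF
          exact hy (Finset.mem_erase.2 ⟨ne_of_lt hyp, hyF⟩)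
        have ht : Tendsto (fun h : ℝ => p - h) (𝓝[>] 0) (𝓝[<] p) := by
          refine tendsto_nhdsWithin_iff.2 ⟨?_, ?_⟩
          · have : Tendsto (fun h : ℝ => p - h) (𝓝 0) (𝓝 (p - 0)) :=
              (continuous_const.sub continuous_id).tendsto 0
            rw [sub_zero] at this
            exact this.mono_left nhdsWithin_le_nhds
          · filter_upwards [self_mem_nhdsWithin] with h hh
            exact sub_lt_self p hh
        exact ht.eventually this
      have e2 : ∀ᶠ h in 𝓝[>] (0 : ℝ), h ∈ Ioc 0 (min p (x - p)) :=
        Ioc_mem_nhdsGT (lt_min hp0 (sub_pos.2 hpx))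
      obtain ⟨h, hh, hhF, hh0, hhle⟩ :=
        ((hjump p hpF (hpx.trans_le hx.2) ε hε).and (e1.and e2)).exists
      have hhp := hhle.trans (min_le_left _ _)
      have hhx := hhle.trans (min_le_right _ _)
      have hlow : 0 ≤ G (p - h) := by
        refine ih _ ?_ (x := p - h) ⟨by linarith, by linarith [hx.2]⟩ hhF rfl
        rw [← hn]
        refine Finset.card_lt_card ⟨fun y hy => ?_, fun hsub => ?_⟩
        · obtain ⟨hyF, hyp⟩ := Finset.mem_filter.1 hy
          exact Finset.mem_filter.2 ⟨hyF, by linarith⟩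
        · have := (Finset.mem_filter.1 (hsub hp)).2
          linarith
      have hup : G (p + h) ≤ G x := by
        refine hmono _ ⟨by linarith, by linarith [hx.2]⟩ x hx (by linarith) fun q hq hqx => ?_
        have hlt : q < x := lt_of_le_of_ne hqx.2 fun h => hxF (h ▸ hq)
        have h1 : q ≤ p := hpmax q (Finset.mem_filter.2 ⟨hq, hlt⟩)
        linarith [hqx.1]
      linarith

/-! ### The Kraus-type criterion -/

section Kraus

variable {k : ℕ} {α : EReal} {f : ℝ → ℝ}

lemma interpolationError_eq_mul (I : Set ℝ) (f : ℝ → ℝ) (s t a : ℝ) :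
    interpolationError I f s t a = (a - s) * (dividedDiff I f s a - dividedDiff I f s t) := by
  have h := dividedDiff_mul_sub I f s a
  unfold interpolationError
  linear_combination h

/-- The second divided difference `[s, t, a]` is differentiable in `a`, with derivative
`[s, t, a, a]`. -/
lemma hasDerivAt_interpolationError_div (hf : ContDiffOn ℝ 1 f (halfOpenInterval α)) {a : ℝ}
    (ha : a ∈ halfOpenInterval α) (h0 : 0 < a) {s t : ℝ} (hs : a ≠ s) (ht : a ≠ t) :
    HasDerivAt (fun x => interpolationError (halfOpenInterval α) f s t x / ((x - s) * (x - t)))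
      ((dividedDiff (halfOpenInterval α) f s t - dividedDiff (halfOpenInterval α) f s a
        - dividedDiff (halfOpenInterval α) f t a + dividedDiff (halfOpenInterval α) f a a)
        / ((a - s) * (a - t))) a := by
  have hs' := sub_ne_zero.2 hs
  have ht' := sub_ne_zero.2 ht
  have e1 : HasDerivAt (interpolationError (halfOpenInterval α) f s t)
      (derivWithin f (halfOpenInterval α) a - dividedDiff (halfOpenInterval α) f s t) a := by
    have := ((hasDerivAt_of_contDiffOn_halfOpenInterval hf ha h0).sub_const (f s)).sub
      (((hasDerivAt_id a).sub_const s).const_mul (dividedDiff (halfOpenInterval α) f s t))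
    rw [mul_one] at this
    exact this
  have e2 := ((hasDerivAt_id a).sub_const s).mul ((hasDerivAt_id a).sub_const t)
  have h := e1.div e2 (mul_ne_zero hs' ht')
  refine h.congr_deriv ?_
  have h1 := interpolationError_eq_mul (halfOpenInterval α) f s t a
  have h2 := interpolationError_eq_mul (halfOpenInterval α) f t s a
  rw [interpolationError_comm, dividedDiff_comm _ _ t s] at h2
  rw [dividedDiff_self]
  have h3 : ((fun x : ℝ => id x - s) * fun x : ℝ => id x - t) a = (a - s) * (a - t) := rfl
  rw [h3]
  simp only [id]
  field_simp
  linear_combination -(a - t) * h1 - (a - s) * h2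

/-- Cancelling x - s leaves ([s, x] - [s, t])/(x - t), which is continuous at p because t ≠ p, even
when s = p. -/
lemma tendsto_interpolationError_div (hf : ContDiffOn ℝ 1 f (halfOpenInterval α)) {p : ℝ}
    (hp : p ∈ halfOpenInterval α) (h0 : 0 < p) {s t : ℝ} (hs : s ∈ halfOpenInterval α)
    (hs0 : 0 < s) (ht : t ≠ p) :
    ∃ l, Tendsto
      (fun x => interpolationError (halfOpenInterval α) f s t x / ((x - s) * (x - t)))
      (𝓝[≠] p) (𝓝 l) := by
  have hfp := (hasDerivAt_of_contDiffOn_halfOpenInterval hf hp h0)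
  have hc : ContinuousAt (dslope f s) p := by
    by_cases h : p = s
    · subst h
      exact continuousAt_dslope_same.2 hfp.differentiableAt
    · exact (continuousAt_dslope_of_ne h).2 hfp.continuousAt
  have hc2 : ContinuousAt (fun x => (dslope f s x - dividedDiff (halfOpenInterval α) f s t)
      / (x - t)) p :=
    (hc.sub continuousAt_const).div (continuousAt_id.sub continuousAt_const)
      (sub_ne_zero.2 (Ne.symm ht))
  refine ⟨_, (hc2.tendsto.mono_left nhdsWithin_le_nhds).congr' ?_⟩
  have hne : ∀ᶠ x in 𝓝[≠] p, x ≠ s := by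
    by_cases h : p = s
    · subst h; exact self_mem_nhdsWithin
    · exact (eventually_ne_nhds h).filter_mono nhdsWithin_le_nhds
  filter_upwards [hne] with x hx
  rw [interpolationError_eq_mul, dividedDiff_eq_dslope hf hs hs0 x,
    mul_div_mul_left _ _ (sub_ne_zero.2 hx)]

/-- If at most one node equals p, the second divided difference has a two-sided limit at p, so its
symmetric difference vanishes in the limit. Two nodes at p would need a second derivative. -/
lemma tendsto_add_sub_interpolationError_div (hf : ContDiffOn ℝ 1 f (halfOpenInterval α))
    {p : ℝ} (hp : p ∈ halfOpenInterval α) (h0 : 0 < p) {s t : ℝ} (hs : s ∈ halfOpenInterval α)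
    (hs0 : 0 < s) (ht : t ∈ halfOpenInterval α) (ht0 : 0 < t) (hst : ¬(s = p ∧ t = p)) :
    Tendsto (fun h =>
      interpolationError (halfOpenInterval α) f s t (p + h) / ((p + h - s) * (p + h - t)) -
      interpolationError (halfOpenInterval α) f s t (p - h) / ((p - h - s) * (p - h - t)))
      (𝓝[>] 0) (𝓝 0) := by
  obtain ⟨l, hl⟩ : ∃ l, Tendsto
      (fun x => interpolationError (halfOpenInterval α) f s t x / ((x - s) * (x - t)))
      (𝓝[≠] p) (𝓝 l) := by
    by_cases h : t = p
    · obtain ⟨l, hl⟩ := tendsto_interpolationError_div hf hp h0 ht ht0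
        (fun hs' : s = p => hst ⟨hs', h⟩)
      refine ⟨l, hl.congr fun x => ?_⟩
      rw [interpolationError_comm, mul_comm]
    · exact tendsto_interpolationError_div hf hp h0 hs hs0 h
  have hplus : Tendsto (fun h : ℝ => p + h) (𝓝[>] 0) (𝓝[≠] p) := by
    refine tendsto_nhdsWithin_iff.2 ⟨?_, ?_⟩
    · have : Tendsto (fun h : ℝ => p + h) (𝓝 0) (𝓝 (p + 0)) :=
        (continuous_const.add continuous_id).tendsto 0
      rw [add_zero] at this
      exact this.mono_left nhdsWithin_le_nhds
    · filter_upwards [self_mem_nhdsWithin] with h hh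
      exact (lt_add_of_pos_right p hh).ne'
  have hminus : Tendsto (fun h : ℝ => p - h) (𝓝[>] 0) (𝓝[≠] p) := by
    refine tendsto_nhdsWithin_iff.2 ⟨?_, ?_⟩
    · have : Tendsto (fun h : ℝ => p - h) (𝓝 0) (𝓝 (p - 0)) :=
        (continuous_const.sub continuous_id).tendsto 0
      rw [sub_zero] at this
      exact this.mono_left nhdsWithin_le_nhds
    · filter_upwards [self_mem_nhdsWithin] with h hh
      exact (sub_lt_self p hh).ne
  simpa using (hl.comp hplus).sub (hl.comp hminus)

lemma sum_interpolationError_nonneg_of_notMem (hk : 1 ≤ k)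
    (hf : f ∈ classQ (k + 1) (halfOpenInterval α))
    (hmono : IsMatrixMonotoneOn k (halfOpenInterval α) (derivWithin f (halfOpenInterval α)))
    {c : Fin k → ℝ} (hc : ∀ i, c i ∈ halfOpenInterval α) (hc0 : ∀ i, 0 < c i)
    {b : ℝ} (hb : b ∈ halfOpenInterval α) (hbc : ∀ i, b ≠ c i) (v : Fin k → ℝ) :
    0 ≤ ∑ i, ∑ j, v i * v j * interpolationError (halfOpenInterval α) f (c i) (c j) b := by
  set I := halfOpenInterval α with hI
  let τ : Fin k → Fin k → ℝ → ℝ := fun i j x =>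
    interpolationError I f (c i) (c j) x / ((x - c i) * (x - c j))
  suffices h : ∀ w : Fin k → ℝ, 0 ≤ ∑ i, ∑ j, w i * w j * τ i j b by
    refine (h fun i => v i * (b - c i)).trans_eq
      (Finset.sum_congr rfl fun i _ => Finset.sum_congr rfl fun j _ => ?_)
    have hi := sub_ne_zero.2 (hbc i)
    have hj := sub_ne_zero.2 (hbc j)
    simp only [τ]
    field_simp
  intro w
  have hmem : ∀ x ∈ Icc 0 b, x ∈ I := fun x hx => halfOpenInterval_mem_of_le hb hx.1 hx.2
  have hF : ∀ x, x ∉ Finset.univ.image c ↔ ∀ i, x ≠ c i := by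
    intro x
    simp [eq_comm]
  refine nonneg_of_deriv_nonneg_of_jump (b := b) (F := Finset.univ.image c)
    (G := fun x => ∑ i, ∑ j, w i * w j * τ i j x)
    (G' := fun x => ∑ i, ∑ j, w i * w j * ((dividedDiff I f (c i) (c j) - dividedDiff I f (c i) x
        - dividedDiff I f (c j) x + dividedDiff I f x x) / ((x - c i) * (x - c j))))
    ?_ ?_ ?_ ?_ ?_ ⟨hb.1, le_rfl⟩ ((hF b).2 hbc)
  · refine continuousOn_finsetSum _ fun i _ => continuousOn_finsetSum _ fun j _ =>
      continuousOn_const.mul (ContinuousOn.div ?_ (by fun_prop) ?_)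
    · refine ContinuousOn.sub (ContinuousOn.sub ?_ continuousOn_const) (by fun_prop)
      exact hf.1.continuousOn.mono fun x hx => hmem x hx.1
    · intro x hx
      have hx' := (hF x).1 hx.2
      exact mul_ne_zero (sub_ne_zero.2 (hx' i)) (sub_ne_zero.2 (hx' j))
  · intro x hx hxF
    have hx' := (hF x).1 hxF
    have hxI := hmem x ⟨hx.1.le, hx.2.le⟩
    refine ⟨HasDerivAt.fun_sum fun i _ => HasDerivAt.fun_sum fun j _ => HasDerivAt.const_mul _
      (hasDerivAt_interpolationError_div hf.1 hxI hx.1 (hx' i) (hx' j)), ?_⟩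
    -- The denominators split as a product over i and j, hence can be moved into the weights.
    refine (classQ_sum_nonneg hf hc hxI fun i => w i / (x - c i)).trans_eq
      (Finset.sum_congr rfl fun i _ => Finset.sum_congr rfl fun j _ => ?_)
    rw [div_mul_div_comm, div_mul_eq_mul_div, mul_div_assoc]
  · simpa using hc0
  · refine (sum_interpolationError_zero_nonneg hf.1 hmono hc hc0 fun i => w i / c i).trans_eq
      (Finset.sum_congr rfl fun i _ => Finset.sum_congr rfl fun j _ => ?_)
    simp only [τ, zero_sub, neg_mul_neg]
    rw [div_mul_div_comm, div_mul_eq_mul_div, mul_div_assoc]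
  · intro p hpF hpb ε hε
    obtain ⟨i₀, -, rfl⟩ := Finset.mem_image.1 hpF
    set p := c i₀ with hp
    have hpI : p ∈ I := hc i₀
    have hp0 : 0 < p := hc0 i₀
    -- R collects the pairs of nodes not both equal to p. The remaining pairs all share the
    -- increment δ below, so their weights add up to a square.
    let R : ℝ → ℝ := fun h => ∑ i, ∑ j, if c i = p ∧ c j = p then 0 else
      w i * w j * (τ i j (p + h) - τ i j (p - h))
    have hR : Tendsto R (𝓝[>] 0) (𝓝 0) := by
      rw [show (0 : ℝ) = ∑ i : Fin k, ∑ j : Fin k, 0 by simp]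
      refine tendsto_finsetSum _ fun i _ => tendsto_finsetSum _ fun j _ => ?_
      by_cases hij : c i = p ∧ c j = p
      · simp only [if_pos hij]
        exact tendsto_const_nhds
      · simp only [if_neg hij]
        simpa using! (tendsto_add_sub_interpolationError_div hf.1 hpI hp0 (hc i) (hc0 i) (hc j)
          (hc0 j) hij).const_mul (w i * w j)
    filter_upwards [hR.eventually (lt_mem_nhds (neg_lt_zero.2 hε)), self_mem_nhdsWithin,
      Ioo_mem_nhdsGT hp0, eventually_add_mem_halfOpenInterval hpI] with h hRh hh hhp hph
    have hh : 0 < h := hh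
    have hsc := classQ_two_mul_derivWithin_le hk hf hh (sub_pos.2 hhp.2) hph
    set δ := (f (p + h) - f (p - h) - 2 * h * derivWithin f I p) / h ^ 2 with hδ
    have hδ0 : 0 ≤ δ := div_nonneg (by linarith) (sq_nonneg h)
    have key : ∑ i, ∑ j, w i * w j * τ i j (p + h) - ∑ i, ∑ j, w i * w j * τ i j (p - h)
        = R h + (∑ i, if c i = p then w i else 0) ^ 2 * δ := by
      rw [sq, Finset.sum_mul_sum, Finset.sum_mul]
      simp only [Finset.sum_mul, R, ← Finset.sum_add_distrib, ← Finset.sum_sub_distrib]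
      refine Finset.sum_congr rfl fun i _ => Finset.sum_congr rfl fun j _ => ?_
      by_cases hi : c i = p
      · by_cases hj : c j = p
        · simp only [hi, hj, and_self, if_true, τ, interpolationError, dividedDiff_self, hδ]
          have : h ≠ 0 := hh.ne'
          rw [show p + h - p = h by ring, show p - h - p = -h by ring]
          field_simp
          ring
        · simp [hi, hj]; ring
      · simp [hi]; ring
    have := mul_nonneg (sq_nonneg (∑ i, if c i = p then w i else 0)) hδ0
    linarith

/-- The Kraus-type criterion: the matrices of interpolation errors are positive semidefinite. -/
lemma sum_interpolationError_nonneg (hk : 1 ≤ k) (hα : 0 < α)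
    (hf : f ∈ classQ (k + 1) (halfOpenInterval α))
    (hmono : IsMatrixMonotoneOn k (halfOpenInterval α) (derivWithin f (halfOpenInterval α)))
    {c : Fin k → ℝ} (hc : ∀ i, c i ∈ halfOpenInterval α)
    {b : ℝ} (hb : b ∈ halfOpenInterval α) (v : Fin k → ℝ) :
    0 ≤ ∑ i, ∑ j, v i * v j * interpolationError (halfOpenInterval α) f (c i) (c j) b := by
  set I := halfOpenInterval α with hI
  have hlim1 : ∀ {g : ℝ → ℝ} {t : ℝ}, ContinuousOn g I → t ∈ I →
      Tendsto (fun e => g (t + e)) (𝓝[>] 0) (𝓝 (g t)) := by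
    intro g t hg ht
    refine (hg t ht).tendsto.comp (tendsto_nhdsWithin_iff.2
      ⟨?_, eventually_add_mem_halfOpenInterval ht⟩)
    have : Tendsto (fun e : ℝ => t + e) (𝓝 0) (𝓝 (t + 0)) :=
      (continuous_const.add continuous_id).tendsto 0
    rw [add_zero] at this
    exact this.mono_left nhdsWithin_le_nhds
  have htwo : Tendsto (fun e : ℝ => 2 * e) (𝓝[>] 0) (𝓝[>] 0) := by
    refine tendsto_nhdsWithin_iff.2 ⟨?_, ?_⟩
    · have : Tendsto (fun e : ℝ => 2 * e) (𝓝 0) (𝓝 (2 * 0)) :=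
        (continuous_const.mul continuous_id).tendsto 0
      rw [mul_zero] at this
      exact this.mono_left nhdsWithin_le_nhds
    · filter_upwards [self_mem_nhdsWithin] with e he
      exact mul_pos two_pos (show (0 : ℝ) < e from he)
  have hdd : ∀ s ∈ I, ∀ t ∈ I, Tendsto (fun e => dividedDiff I f (s + e) (t + e)) (𝓝[>] 0)
      (𝓝 (dividedDiff I f s t)) := by
    intro s hs t ht
    by_cases hst : s = t
    · subst hst
      simp only [dividedDiff_self]
      exact hlim1 (hf.1.continuousOn_derivWithin (uniqueDiffOn_halfOpenInterval hα) le_rfl) hs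
    · simp only [dividedDiff, add_left_inj, if_neg hst, add_sub_add_right_eq_sub]
      exact ((hlim1 hf.1.continuousOn hs).sub (hlim1 hf.1.continuousOn ht)).div_const _
  -- Shifting the nodes by e makes them positive; shifting b by 2e separates it from every node for
  -- small e > 0, even from those equal to b.
  have hlim : Tendsto (fun e => ∑ i, ∑ j, v i * v j *
      interpolationError I f (c i + e) (c j + e) (b + 2 * e)) (𝓝[>] 0)
      (𝓝 (∑ i, ∑ j, v i * v j * interpolationError I f (c i) (c j) b)) := by
    refine tendsto_finsetSum _ fun i _ => tendsto_finsetSum _ fun j _ =>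
      Tendsto.const_mul _ (Tendsto.sub (Tendsto.sub ?_ (hlim1 hf.1.continuousOn (hc i)))
        (Tendsto.mul (hdd _ (hc i) _ (hc j)) (Tendsto.sub ?_ ?_)))
    · exact (hlim1 hf.1.continuousOn hb).comp htwo
    · exact (hlim1 (g := id) continuousOn_id hb).comp htwo
    · exact hlim1 (g := id) continuousOn_id (hc i)
  refine ge_of_tendsto hlim ?_
  have hne : ∀ᶠ e in 𝓝[>] (0 : ℝ), ∀ i, b + 2 * e ≠ c i + e := by
    rw [eventually_all]
    intro i
    by_cases h : c i - b = 0
    · filter_upwards [self_mem_nhdsWithin] with e he heq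
      exact (ne_of_gt (show (0 : ℝ) < e from he)) (by linarith)
    · filter_upwards [(eventually_ne_nhds (Ne.symm h)).filter_mono nhdsWithin_le_nhds] with e he heq
      exact he (by linarith)
  have hcI : ∀ᶠ e in 𝓝[>] (0 : ℝ), ∀ i, c i + e ∈ I :=
    eventually_all.2 fun i => eventually_add_mem_halfOpenInterval (hc i)
  filter_upwards [hne, hcI, htwo.eventually (eventually_add_mem_halfOpenInterval hb),
    self_mem_nhdsWithin] with e he hce hbe he0
  exact sum_interpolationError_nonneg_of_notMem hk hf hmono hce
    (fun i => add_pos_of_nonneg_of_pos (hc i).1 he0) hbe he v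

end Kraus

/-! ### From the scalar criterion to matrix convexity -/

section Convexity

variable {k : ℕ}

/-- Because `E` is real, the real part splits into the forms at Re β and Im β. -/
lemma re_sum_mul_nonneg_of_real {E : Fin k → Fin k → ℝ}
    (hE : ∀ v : Fin k → ℝ, 0 ≤ ∑ i, ∑ j, v i * v j * E i j) (β : Fin k → ℂ) :
    0 ≤ (∑ i, ∑ j, star (β i) * β j * (E i j : ℂ)).re := by
  have h := add_nonneg (hE fun i => (β i).re) (hE fun i => (β i).im)
  rw [← Finset.sum_add_distrib] at h
  refine h.trans_eq ?_
  simp only [Complex.re_sum, ← Finset.sum_add_distrib]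
  refine Finset.sum_congr rfl fun i _ => Finset.sum_congr rfl fun j _ => ?_
  simp [Complex.mul_re]
  ring

lemma Matrix.IsHermitian.conjTranspose_mul_cfc_mul_apply {X : Matrix (Fin k) (Fin k) ℂ}
    (hX : X.IsHermitian) (W : Matrix (Fin k) (Fin k) ℂ) (h : ℝ → ℝ) (i j : Fin k) :
    (Wᴴ * cfc h X * W) i j = ∑ l, (h (hX.eigenvalues l) : ℂ) *
      ((Wᴴ * (hX.eigenvectorUnitary : Matrix (Fin k) (Fin k) ℂ)) i l *
        star ((Wᴴ * (hX.eigenvectorUnitary : Matrix (Fin k) (Fin k) ℂ)) j l)) := by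
  set U := (hX.eigenvectorUnitary : Matrix (Fin k) (Fin k) ℂ) with hU
  have e : Wᴴ * cfc h X * W =
      (Wᴴ * U) * (diagonal fun l => (h (hX.eigenvalues l) : ℂ)) * (Wᴴ * U)ᴴ := by
    have : cfc h X = U * (diagonal fun l => (h (hX.eigenvalues l) : ℂ)) * Uᴴ := by
      rw [hX.cfc_eq, IsHermitian.cfc, Unitary.conjStarAlgAut_apply]
      rfl
    rw [this, conjTranspose_mul, conjTranspose_conjTranspose]
    simp only [Matrix.mul_assoc]
  rw [e, Matrix.mul_apply]
  refine Finset.sum_congr rfl fun l _ => ?_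
  rw [Matrix.mul_diagonal, Matrix.conjTranspose_apply]
  ring

/-- The compression of `f(X)` to a unitary frame, corrected by an entrywise affine expression in
`X`, is positive semidefinite as soon as its scalar counterparts are. -/
lemma Matrix.IsHermitian.re_sum_conjTranspose_mul_cfc_nonneg {X : Matrix (Fin k) (Fin k) ℂ}
    (hX : X.IsHermitian) {W : Matrix (Fin k) (Fin k) ℂ} (hW : Wᴴ * W = 1) {f : ℝ → ℝ}
    {d r : Fin k → Fin k → ℝ}
    (hE : ∀ x ∈ spectrum ℝ X, ∀ v : Fin k → ℝ,
      0 ≤ ∑ i, ∑ j, v i * v j * (f x - d i j * x - r i j)) (β : Fin k → ℂ) :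
    0 ≤ (∑ i, ∑ j, star (β i) * β j * ((Wᴴ * cfc f X * W) i j - d i j * (Wᴴ * X * W) i j
      - r i j * (1 : Matrix (Fin k) (Fin k) ℂ) i j)).re := by
  have hX' : IsSelfAdjoint X := hX
  set N := Wᴴ * (hX.eigenvectorUnitary : Matrix (Fin k) (Fin k) ℂ) with hN
  have h1 : ∀ i j, (1 : Matrix (Fin k) (Fin k) ℂ) i j = ∑ l, (N i l * star (N j l)) := by
    intro i j
    have := hX.conjTranspose_mul_cfc_mul_apply W (fun _ => 1) i j
    rw [cfc_const_one ℝ X, Matrix.mul_one, hW] at this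
    simpa using this
  have h2 : ∀ i j, (Wᴴ * X * W) i j
      = ∑ l, (hX.eigenvalues l : ℂ) * (N i l * star (N j l)) := by
    intro i j
    have := hX.conjTranspose_mul_cfc_mul_apply W (fun x => x) i j
    rwa [cfc_id' ℝ X] at this
  have key : ∑ i, ∑ j, star (β i) * β j * ((Wᴴ * cfc f X * W) i j - d i j * (Wᴴ * X * W) i j
      - r i j * (1 : Matrix (Fin k) (Fin k) ℂ) i j) =
      ∑ l, ∑ i, ∑ j, star (star (N i l) * β i) * (star (N j l) * β j) *
        ((f (hX.eigenvalues l) - d i j * hX.eigenvalues l - r i j : ℝ) : ℂ) := by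
    rw [Finset.sum_comm]
    conv_rhs => rw [Finset.sum_comm]; enter [2, i]; rw [Finset.sum_comm]
    rw [Finset.sum_comm]
    refine Finset.sum_congr rfl fun i _ => Finset.sum_congr rfl fun j _ => ?_
    rw [hX.conjTranspose_mul_cfc_mul_apply, h1, h2]
    simp only [Finset.mul_sum, ← Finset.sum_sub_distrib]
    refine Finset.sum_congr rfl fun l _ => ?_
    push_cast
    rw [star_mul', star_star]
    ring
  rw [key, Complex.re_sum]
  exact Finset.sum_nonneg fun l _ =>
    re_sum_mul_nonneg_of_real (hE _ (hX.eigenvalues_mem_spectrum_real l)) _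

lemma dotProduct_mulVec_eq_sum_conjTranspose_mul {W : Matrix (Fin k) (Fin k) ℂ}
    (hW : W * Wᴴ = 1) (M : Matrix (Fin k) (Fin k) ℂ) (v : Fin k → ℂ) :
    star v ⬝ᵥ (M *ᵥ v) =
      ∑ i, ∑ j, star ((Wᴴ *ᵥ v) i) * (Wᴴ *ᵥ v) j * (Wᴴ * M * W) i j := by
  have e : ∑ i, ∑ j, star ((Wᴴ *ᵥ v) i) * (Wᴴ *ᵥ v) j * (Wᴴ * M * W) i j =
      star (Wᴴ *ᵥ v) ⬝ᵥ ((Wᴴ * M * W) *ᵥ (Wᴴ *ᵥ v)) := by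
    generalize Wᴴ *ᵥ v = u
    simp only [dotProduct, mulVec, Finset.mul_sum, Pi.star_apply]
    refine Finset.sum_congr rfl fun i _ => Finset.sum_congr rfl fun j _ => ?_
    ring
  rw [e, mulVec_mulVec, Matrix.mul_assoc, hW, Matrix.mul_one, star_mulVec,
    conjTranspose_conjTranspose, ← dotProduct_mulVec, mulVec_mulVec, ← Matrix.mul_assoc, hW,
    Matrix.one_mul]

/-- The numerical range of a Hermitian matrix lies in every convex set containing the spectrum. -/
lemma Matrix.IsHermitian.re_dotProduct_mulVec_mem {X : Matrix (Fin k) (Fin k) ℂ}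
    (hX : X.IsHermitian) {I : Set ℝ} (hI : Convex ℝ I) (hs : spectrum ℝ X ⊆ I)
    {v : Fin k → ℂ} (hv : star v ⬝ᵥ v = 1) : (star v ⬝ᵥ (X *ᵥ v)).re ∈ I := by
  have hX' : IsSelfAdjoint X := hX
  have h1 := hX.re_dotProduct_cfc_mulVec (fun _ => 1) v
  have h2 := hX.re_dotProduct_cfc_mulVec (fun x => x) v
  rw [cfc_const_one ℝ X, one_mulVec, hv, Complex.one_re] at h1
  simp only [one_mul] at h1
  rw [cfc_id' ℝ X] at h2
  rw [h2]
  simp only [mul_comm (hX.eigenvalues _)]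
  exact hI.sum_mem (fun l _ => Complex.normSq_nonneg _) h1.symm
    fun l _ => hs (hX.eigenvalues_mem_spectrum_real l)

/-- An eigenvalue is the value of the quadratic form at a unit eigenvector, hence a convex
combination of numerical-range values of `A` and `B`. -/
lemma spectrum_convex_combination_subset {A B : Matrix (Fin k) (Fin k) ℂ} (hA : A.IsHermitian)
    (hB : B.IsHermitian) {I : Set ℝ} (hI : Convex ℝ I) (hsA : spectrum ℝ A ⊆ I)
    (hsB : spectrum ℝ B ⊆ I) {c : ℝ} (hc : c ∈ Icc (0 : ℝ) 1) :
    spectrum ℝ (c • A + (1 - c) • B) ⊆ I := by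
  have hC : (c • A + (1 - c) • B).IsHermitian :=
    (hA.smul (IsSelfAdjoint.all c)).add (hB.smul (IsSelfAdjoint.all (1 - c)))
  rw [hC.spectrum_real_eq_range_eigenvalues]
  rintro _ ⟨l, rfl⟩
  set v : Fin k → ℂ := (hC.eigenvectorBasis l : Fin k → ℂ)
  have hv : star v ⬝ᵥ v = 1 := by
    have h := hC.eigenvectorBasis.orthonormal.1 l
    have h2 : inner ℂ (hC.eigenvectorBasis l) (hC.eigenvectorBasis l) = (1 : ℂ) := by
      rw [inner_self_eq_norm_sq_to_K, h]
      simp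
    rw [EuclideanSpace.inner_eq_star_dotProduct, dotProduct_comm] at h2
    exact h2
  have he : hC.eigenvalues l = c * (star v ⬝ᵥ (A *ᵥ v)).re
      + (1 - c) * (star v ⬝ᵥ (B *ᵥ v)).re := by
    have h := hC.mulVec_eigenvectorBasis l
    have h2 : (star v ⬝ᵥ ((c • A + (1 - c) • B) *ᵥ v)).re = hC.eigenvalues l := by
      rw [h, dotProduct_smul, hv]
      simp
    rw [← h2, add_mulVec, smul_mulVec, smul_mulVec, dotProduct_add, dotProduct_smul,
      dotProduct_smul]
    simp
  rw [he]
  exact hI (hA.re_dotProduct_mulVec_mem hI hsA hv) (hB.re_dotProduct_mulVec_mem hI hsB hv)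
    hc.1 (sub_nonneg.2 hc.2) (by ring)

end Convexity

theorem mainTheorem3 (n : ℕ) (hn : 2 ≤ n) (α : EReal) (hα : 0 < α) (f : ℝ → ℝ)
    (hf : f ∈ classQ n (halfOpenInterval α))
    (hmono : IsMatrixMonotoneOn (n - 1) (halfOpenInterval α)
      (derivWithin f (halfOpenInterval α))) :
    IsMatrixConvexOn (n - 1) (halfOpenInterval α) f := by
  obtain ⟨k, rfl⟩ : ∃ k, n = k + 1 := ⟨n - 1, by omega⟩
  rw [Nat.add_sub_cancel] at hmono ⊢
  intro A B hA hB hsA hsB c hc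
  set I := halfOpenInterval α with hI
  set C := c • A + (1 - c) • B with hCdef
  have hC : C.IsHermitian :=
    (hA.smul (IsSelfAdjoint.all c)).add (hB.smul (IsSelfAdjoint.all (1 - c)))
  have hCs : IsSelfAdjoint C := hC
  have hsC : spectrum ℝ C ⊆ I :=
    spectrum_convex_combination_subset hA hB (convex_halfOpenInterval α) hsA hsB hc
  have hherm : ((c • cfc f A + (1 - c) • cfc f B) - cfc f C).IsHermitian :=
    (((isHermitian_cfc f A).smul (IsSelfAdjoint.all c)).add
      ((isHermitian_cfc f B).smul (IsSelfAdjoint.all (1 - c)))).sub (isHermitian_cfc f C)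
  refine hherm.posSemidef_of_re_nonneg fun v => ?_
  set W := (hC.eigenvectorUnitary : Matrix (Fin k) (Fin k) ℂ) with hWdef
  have hW1 : Wᴴ * W = 1 := Unitary.coe_star_mul_self hC.eigenvectorUnitary
  have hW2 : W * Wᴴ = 1 := Unitary.coe_mul_star_self hC.eigenvectorUnitary
  let γ := hC.eigenvalues
  let d : Fin k → Fin k → ℝ := fun i j => dividedDiff I f (γ i) (γ j)
  -- The interpolation error at γ_i, γ_j is f(x) - (d_ij x + r_ij), an affine correction to which
  -- the functional calculus applies entry by entry.
  let r : Fin k → Fin k → ℝ := fun i j => f (γ i) - d i j * γ i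
  let β := Wᴴ *ᵥ v
  have hE : ∀ x ∈ I, ∀ w : Fin k → ℝ,
      0 ≤ ∑ i, ∑ j, w i * w j * (f x - d i j * x - r i j) := by
    intro x hx w
    refine (sum_interpolationError_nonneg (by omega) hα hf hmono
      (fun i => hsC (hC.eigenvalues_mem_spectrum_real i)) hx w).trans_eq
      (Finset.sum_congr rfl fun i _ => Finset.sum_congr rfl fun j _ => ?_)
    simp only [interpolationError, r, d, γ, hI]
    ring
  have hpA := hA.re_sum_conjTranspose_mul_cfc_nonneg hW1 (fun x hx => hE x (hsA hx)) β
  have hpB := hB.re_sum_conjTranspose_mul_cfc_nonneg hW1 (fun x hx => hE x (hsB hx)) β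
  have hdiag : ∀ (h : ℝ → ℝ) i j, (Wᴴ * cfc h C * W) i j
      = h (γ i) * (1 : Matrix (Fin k) (Fin k) ℂ) i j := by
    intro h i j
    rw [hC.conjTranspose_mul_cfc_mul_apply, ← hWdef, hW1, Finset.sum_eq_single i]
    · by_cases hij : i = j
      · subst hij; simp [γ]
      · simp [hij, Ne.symm hij]
    · intro l _ hl
      simp [Ne.symm hl]
    · simp
  -- Off the diagonal the average vanishes, which removes d_ij; on it, d_ii γ_i + r_ii = f(γ_i).
  have hCW : ∀ i j, c * (Wᴴ * A * W) i j + (1 - c) * (Wᴴ * B * W) i j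
      = γ i * (1 : Matrix (Fin k) (Fin k) ℂ) i j := by
    intro i j
    have h := hdiag (fun x => x) i j
    rw [cfc_id' ℝ C] at h
    rw [← h, hCdef]
    simp [Matrix.mul_add, Matrix.add_mul]
  have hentry : ∀ i j, (Wᴴ * (c • cfc f A + (1 - c) • cfc f B - cfc f C) * W) i j =
      c * ((Wᴴ * cfc f A * W) i j - d i j * (Wᴴ * A * W) i j
        - r i j * (1 : Matrix (Fin k) (Fin k) ℂ) i j) +
      (1 - c) * ((Wᴴ * cfc f B * W) i j - d i j * (Wᴴ * B * W) i j
        - r i j * (1 : Matrix (Fin k) (Fin k) ℂ) i j) := by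
    intro i j
    have e : (Wᴴ * (c • cfc f A + (1 - c) • cfc f B - cfc f C) * W) i j =
        c * (Wᴴ * cfc f A * W) i j + (1 - c) * (Wᴴ * cfc f B * W) i j
          - (Wᴴ * cfc f C * W) i j := by
      simp [Matrix.mul_add, Matrix.add_mul, Matrix.mul_sub, Matrix.sub_mul]
    rw [e, hdiag f]
    simp only [r]
    push_cast
    linear_combination (d i j : ℂ) * hCW i j
  have hsum := add_nonneg (mul_nonneg hc.1 hpA) (mul_nonneg (sub_nonneg.2 hc.2) hpB)
  refine hsum.trans_eq ?_
  rw [dotProduct_mulVec_eq_sum_conjTranspose_mul hW2]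
  simp only [hentry]
  rw [← Complex.re_ofReal_mul, ← Complex.re_ofReal_mul, ← Complex.add_re]
  congr 1
  simp only [Finset.mul_sum, ← Finset.sum_add_distrib]
  refine Finset.sum_congr rfl fun i _ => Finset.sum_congr rfl fun j _ => ?_
  push_cast
  ring
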